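/- Let $\Theta\subseteq\mathbb R^K$ be open, and for $\theta\in\Theta$ let $g(\cdot;\theta)$ (permanent impact) and $h(\cdot;\theta)$ (temporary impact) be measurable functions of the trading rate. Let $(v,T)$ be a random pair (trading rate and duration) with law $G$ not depending on $\theta$ and with $T_L\le T\le T_U$ almost surely for some constants $0<T_L\le T_U<\infty$; let $W$ be a standard Brownian motion independent of $(v,T)$, and $S_0,\sigma>0$ known constants. Assume that for $G$-almost every $(v,T)$ the maps $\theta\mapsto g(v;\theta)$ and $\theta\mapsto h(v;\theta)$ are differentiable on $\Theta$. In the Almgren–Chriss model the stock price is $$S_t=S_0+S_0\big(g(v;\theta)t+h(v;\theta)\big)+S_0\sigma W_t\quad(0<t\le T),\qquad S_t=S_0+S_0\,g(v;\theta)\,T+S_0\sigma W_t\quad(t>T),$$ and $P_t=(S_t-S_0)/S_0$. Fix $N\ge 1$, ratios $0<\tau_1<\dots<\tau_N=1$ and a delay $\delta>0$; put $t_i=\tau_iT$ (so $t_1$ is the earliest sampling time and $t_N=T$) and $T_{\mathrm{post}}=T+\delta$. Let $\boldsymbol S=\{P_{t_1},\dots,P_{t_N},P_{T_{\mathrm{post}}}\}$.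 For an experiment that observes $X$, consisting of $(v,T)$ and some of these prices, the Fisher information matrix is $$\mathcal I_X(\theta)=\mathbb E_\theta\big[\nabla_\theta \log p_\theta(X)\,\nabla_\theta \log p_\theta(X)^{\mathsf T}\big],$$ where $p_\theta$ is the density of the law of $X$ with respect to a $\sigma$-finite measure not depending on $\theta$, in a version that is differentiable in $\theta\in\Theta$ for almost every sample; it is said to exist if the expectations of all the entries converge absolutely. Then, for every $\theta\in\Theta$, sampling more than three points does not increase the Fisher information: $\mathcal I_{\boldsymbol S}(\theta)$ exists if and only if $\mathcal I_{P_{t_1},P_T,P_{T_{\mathrm{post}}}}(\theta)$ exists, and in that case $$\mathcal I_{\boldsymbol S}(\theta)=\mathcal I_{P_{t_1},P_T,P_{T_{\mathrm{post}}}}(\theta).$$ These matrices depend neither on the dominating measure nor on the version of the density, and they exist at every $\theta$ that has a neighbourhood on which, for $G$-almost every $(v,T)$, $g(v;\cdot)$ and $h(v;\cdot)$ are Lipschitz with a constant not depending on $(v,T)$. -/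

import Mathlib

open MeasureTheory ProbabilityTheory Topology
open scoped NNReal ENNReal

/-! ## Likelihoods and Fisher information of a parametric family of laws -/

/-- `p` is a likelihood, with respect to the `σ`-finite measure `ν`, of the statistical experiment
`(Q θ)_{θ ∈ Θ}`: each `p θ` is a density of `Q θ`, and the densities are chosen so that, for
almost every sample `x`, the likelihood function `θ ↦ p θ x` is differentiable on `Θ`. -/
structure IsLikelihood {K : ℕ} {𝓧 : Type*} [MeasurableSpace 𝓧]
    (Θ : Set (EuclideanSpace ℝ (Fin K))) (Q : EuclideanSpace ℝ (Fin K) → Measure 𝓧)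
    (ν : Measure 𝓧) (p : EuclideanSpace ℝ (Fin K) → 𝓧 → ℝ) : Prop where
  sigmaFinite : SigmaFinite ν
  measurable : ∀ θ ∈ Θ, Measurable (p θ)
  nonneg : ∀ θ ∈ Θ, ∀ x, 0 ≤ p θ x
  law_eq : ∀ θ ∈ Θ, Q θ = ν.withDensity (fun x => ENNReal.ofReal (p θ x))
  differentiable : ∀ᵐ x ∂ν, DifferentiableOn ℝ (fun θ => p θ x) Θ

/-- The `i`-th component of the score, `∂ l(θ | x) / ∂ θᵢ` with `l(θ | x) = log (p θ x)`. -/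
noncomputable def score {K : ℕ} {𝓧 : Type*} (p : EuclideanSpace ℝ (Fin K) → 𝓧 → ℝ)
    (θ : EuclideanSpace ℝ (Fin K)) (i : Fin K) (x : 𝓧) : ℝ :=
  fderiv ℝ (fun θ' => Real.log (p θ' x)) θ (EuclideanSpace.single i 1)

/-- `A` is the Fisher information matrix at `θ` of the experiment `(Q θ)_{θ ∈ Θ}`:
`A = 𝔼_θ [(∂ l / ∂ θ) (∂ l / ∂ θ)ᵀ]`, the entries being convergent integrals under `Q θ`. -/
def HasFisherInformation {K : ℕ} {𝓧 : Type*} [MeasurableSpace 𝓧]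
    (Θ : Set (EuclideanSpace ℝ (Fin K))) (Q : EuclideanSpace ℝ (Fin K) → Measure 𝓧)
    (θ : EuclideanSpace ℝ (Fin K)) (A : Matrix (Fin K) (Fin K) ℝ) : Prop :=
  ∃ (ν : Measure 𝓧) (p : EuclideanSpace ℝ (Fin K) → 𝓧 → ℝ), IsLikelihood Θ Q ν p ∧
    ∀ i j, Integrable (fun x => score p θ i x * score p θ j x) (Q θ) ∧
      A i j = ∫ x, score p θ i x * score p θ j x ∂(Q θ)

/-! ## The Almgren–Chriss model -/

/-- The stock price `S_t` in the Almgren–Chriss model, along the Brownian path `w`, for an order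
executed at constant rate `v` during `[0, T]`; `g` is the permanent and `h` the temporary impact
function. -/
noncomputable def almgrenChrissStock (S₀ σ : ℝ) (g h : ℝ → ℝ) (v T : ℝ) (w : ℝ≥0 → ℝ)
    (t : ℝ) : ℝ :=
  if t ≤ T then S₀ + S₀ * (g v * t + h v) + S₀ * σ * w t.toNNReal
  else S₀ + S₀ * (g v * T) + S₀ * σ * w t.toNNReal

/-- The relative price `P_t = (S_t - S₀) / S₀`. -/
noncomputable def almgrenChrissPrice (S₀ σ : ℝ) (g h : ℝ → ℝ) (v T : ℝ) (w : ℝ≥0 → ℝ)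
    (t : ℝ) : ℝ :=
  (almgrenChrissStock S₀ σ g h v T w t - S₀) / S₀

/-- The law of the sample `(v, T, P_{t 0}, …, P_{t (m-1)})`, where `(v, T)` is drawn from `G`,
independently of the Brownian motion `W`, and the observation times `t = times T` depend on the
duration `T`. -/
noncomputable def almgrenChrissLaw {Ω : Type*} [MeasurableSpace Ω] (P : Measure Ω)
    (W : ℝ≥0 → Ω → ℝ) (G : Measure (ℝ × ℝ)) (S₀ σ : ℝ) (g h : ℝ → ℝ) {m : ℕ}
    (times : ℝ → Fin m → ℝ) : Measure ((ℝ × ℝ) × (Fin m → ℝ)) :=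
  (G.prod P).map (fun y : (ℝ × ℝ) × Ω =>
    (y.1, fun k =>
      almgrenChrissPrice S₀ σ g h y.1.1 y.1.2 (fun t => W t y.2) (times y.1.2 k)))

/-- The times `τ₁ T, …, τ_N T` on the trajectory, followed by `T_post = T + δ`. -/
noncomputable def gridTimes {N : ℕ} (τ : Fin N → ℝ) (δ T : ℝ) : Fin (N + 1) → ℝ :=
  Fin.snoc (α := fun _ => ℝ) (fun i => τ i * T) (T + δ)

/-- The three times `τ₁ T`, `T` and `T_post = T + δ`. -/
def threeTimes (τ₁ δ T : ℝ) : Fin 3 → ℝ :=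
  ![τ₁ * T, T, T + δ]

/-! ## The Cameron–Martin formula for Gaussian measures -/

/-! Given `(v, T)`, the prices form a Gaussian vector with covariance `σ² min(s, t)` and a mean
linear in the impacts `γ = g v`, `η = h v`. On the sampling times this mean is `γ min(t, T) + η
(min(t, t₁)/t₁ - (min(t, T + δ) - min(t, T))/δ)`: the last bracket is `1` on `[t₁, T]` and `0` at `T
+ δ`. So it is a combination of the three covariance columns at `t₁`, `T`, `T + δ`, and by
Cameron–Martin (`map_add_eq_withDensity_exp`) the likelihood ratio against zero impact involves only
these three prices. They are therefore sufficient together with `(v, T)`, and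
`hasFisherInformation_map_iff` transfers the information.

The Fisher information is defined through an arbitrary differentiable likelihood. Any such
likelihood is almost surely a `θ`-free multiple of the explicit positive one
(`IsLikelihood.ae_proportional`), so the scores agree; this gives uniqueness.

For existence, the score at the true parameter is linear in `W` at the three times, with
coefficients bounded through the Lipschitz constant and `T ≥ T_L`, while `T ≤ T_U` bounds the second
moments of `W`. -/

lemma map_eq_map_of_mgf_eq {Ω Ω' : Type*} {mΩ : MeasurableSpace Ω} {mΩ' : MeasurableSpace Ω'}
    {μ : Measure Ω} {μ' : Measure Ω'} [IsProbabilityMeasure μ] [IsFiniteMeasure μ']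
    {X : Ω → ℝ} {Y : Ω' → ℝ} (hX : AEMeasurable X μ) (hY : AEMeasurable Y μ')
    (hint : ∀ t, Integrable (fun ω => Real.exp (t * X ω)) μ) (h : mgf X μ = mgf Y μ') :
    μ.map X = μ'.map Y := by
  refine Measure.ext_of_complexMGF_eq hX hY ?_
  -- All exponential moments are finite, so the strip of analyticity is all of `ℂ` and equality on
  -- the real line continues to it.
  have huniv : integrableExpSet X μ = Set.univ := Set.eq_univ_of_forall hint
  funext z
  refine eqOn_complexMGF_of_mgf h ?_
  simp [huniv]

section CameronMartin

variable {E : Type*} [NormedAddCommGroup E] [NormedSpace ℝ E] [MeasurableSpace E] [BorelSpace E]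
  {μ : Measure E} [IsGaussian μ]

lemma integrable_exp_dual (L : StrongDual ℝ E) : Integrable (fun x => Real.exp (L x)) μ := by
  have h := integrable_exp_mul_gaussianReal (μ := ∫ x, L x ∂μ) (v := Var[L; μ].toNNReal) 1
  rw [← IsGaussian.map_eq_gaussianReal L,
    integrable_map_measure (by fun_prop) (by fun_prop)] at h
  simpa [Function.comp_def] using h

omit [BorelSpace E] in
lemma integral_exp_dual (L : StrongDual ℝ E) :
    ∫ x, Real.exp (L x) ∂μ = Real.exp (∫ x, L x ∂μ + Var[L; μ] / 2) := by
  have h := mgf_gaussianReal (IsGaussian.map_eq_gaussianReal (μ := μ) L) 1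
  simp only [mgf, one_mul, mul_one, one_pow] at h
  rw [h, Real.coe_toNNReal _ (variance_nonneg _ _)]

variable [SecondCountableTopology E] [CompleteSpace E]

/-- **Cameron–Martin formula**: translating a Gaussian measure by the vector `m` that represents
the covariance with the functional `L` multiplies it by the exponential of the centred `L`. -/
theorem map_add_eq_withDensity_exp (L : StrongDual ℝ E) (m : E)
    (hm : ∀ L' : StrongDual ℝ E, L' m = cov[L', L; μ]) :
    μ.map (fun x => x + m) =
      μ.withDensity (fun x => ENNReal.ofReal (Real.exp (L x - ∫ y, L y ∂μ - Var[L; μ] / 2))) := by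
  have hmeas : Measurable fun x => Real.exp (L x - ∫ y, L y ∂μ - Var[L; μ] / 2) := by fun_prop
  have hint : Integrable (fun x => Real.exp (L x - ∫ y, L y ∂μ - Var[L; μ] / 2)) μ := by
    have := (integrable_exp_dual (μ := μ) L).mul_const
      (Real.exp (- ∫ y, L y ∂μ - Var[L; μ] / 2))
    refine this.congr (.of_forall fun x => ?_)
    simp only [← Real.exp_add]
    congr 1; ring
  have hfin : IsFiniteMeasure (μ.withDensity
      (fun x => ENNReal.ofReal (Real.exp (L x - ∫ y, L y ∂μ - Var[L; μ] / 2)))) :=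
    isFiniteMeasure_withDensity_ofReal hint.2
  have hprob : IsProbabilityMeasure (μ.map (fun x => x + m)) :=
    Measure.isProbabilityMeasure_map (by fun_prop)
  refine Measure.ext_of_charFunDual ?_
  ext L'
  -- It suffices to compare the laws of each functional `L'`. Real moment generating functions are
  -- convenient here: the tilt by `exp L` merely replaces `t • L'` by `t • L' + L`.
  rw [charFunDual_eq_charFun_map_one, charFunDual_eq_charFun_map_one]
  congr 1
  refine map_eq_map_of_mgf_eq (by fun_prop) (by fun_prop) (fun t => ?_) ?_
  · rw [integrable_map_measure (by fun_prop) (by fun_prop)]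
    refine ((integrable_exp_dual (μ := μ) (t • L')).mul_const (Real.exp (t * L' m))).congr
      (.of_forall fun x => ?_)
    simp [← Real.exp_add, mul_add]
  · funext t
    have hlhs : mgf L' (μ.map (fun x => x + m)) t =
        (∫ x, Real.exp ((t • L') x) ∂μ) * Real.exp (t * L' m) := by
      rw [mgf, integral_map (by fun_prop) (by fun_prop), ← integral_mul_const]
      simp [← Real.exp_add, mul_add]
    have hrhs : mgf L' (μ.withDensity (fun x =>
          ENNReal.ofReal (Real.exp (L x - ∫ y, L y ∂μ - Var[L; μ] / 2)))) t =
        (∫ x, Real.exp ((t • L' + L) x) ∂μ) * Real.exp (- ∫ y, L y ∂μ - Var[L; μ] / 2) := by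
      rw [mgf, integral_withDensity_eq_integral_toReal_smul (by fun_prop) (by simp),
        ← integral_mul_const]
      refine integral_congr_ae (.of_forall fun x => ?_)
      simp only [ENNReal.toReal_ofReal (Real.exp_pos _).le, smul_eq_mul, ← Real.exp_add]
      congr 1
      simp only [add_apply, smul_apply, smul_eq_mul]
      ring
    have hL : MemLp L 2 μ := (IsGaussian.hasGaussianLaw_id (μ := μ)).map L |>.memLp_two
    have hL' : MemLp (t • L') 2 μ :=
      (IsGaussian.hasGaussianLaw_id (μ := μ)).map (t • L') |>.memLp_two
    rw [hlhs, hrhs, integral_exp_dual, integral_exp_dual, ← Real.exp_add, ← Real.exp_add]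
    congr 1
    -- The cross term is what the tilt adds to the exponent; by `hm` it equals the shift `t * L' m`.
    have hv : Var[t • L' + L; μ] = Var[t • L'; μ] + 2 * cov[t • L', L; μ] + Var[L; μ] := by
      simpa using variance_add (μ := μ) hL' hL
    have hi : ∫ x, (t • L' + L) x ∂μ = ∫ x, (t • L') x ∂μ + ∫ x, L x ∂μ := by
      simp only [add_apply]
      exact integral_add (hL'.integrable (by norm_num)) (hL.integrable (by norm_num))
    have hc : t * L' m = cov[t • L', L; μ] := by simpa using hm (t • L')
    rw [hi, hc]
    have e1 : Var[⇑(t • L' + L); μ] = Var[t • L' + L; μ] := rfl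
    rw [e1, hv]
    simp only [FunLike.coe_smul]
    ring

end CameronMartin

/-! ## Fisher information is independent of the likelihood and preserved by sufficiency -/

section Fisher

variable {K : ℕ} {𝓧 𝓨 : Type*} [MeasurableSpace 𝓧] [MeasurableSpace 𝓨]
  {Θ : Set (EuclideanSpace ℝ (Fin K))} {Q : EuclideanSpace ℝ (Fin K) → Measure 𝓧}
  {ν ν₀ : Measure 𝓧} {p p₀ : EuclideanSpace ℝ (Fin K) → 𝓧 → ℝ}
  {θ : EuclideanSpace ℝ (Fin K)}

lemma IsLikelihood.absolutelyContinuous (h : IsLikelihood Θ Q ν p) (hθ : θ ∈ Θ) : Q θ ≪ ν := by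
  rw [h.law_eq θ hθ]
  exact withDensity_absolutelyContinuous _ _

lemma IsLikelihood.dominating_absolutelyContinuous (h : IsLikelihood Θ Q ν p) (hθ : θ ∈ Θ)
    (hpos : ∀ θ ∈ Θ, ∀ x, 0 < p θ x) : ν ≪ Q θ := by
  rw [h.law_eq θ hθ]
  have := h.measurable θ hθ
  exact withDensity_absolutelyContinuous' (by fun_prop)
    (.of_forall fun x => (ENNReal.ofReal_pos.2 (hpos θ hθ x)).ne')

/-- Almost surely, two likelihood functions of the same experiment are proportional. -/
lemma IsLikelihood.ae_proportional (hθ : θ ∈ Θ)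
    (h₀ : IsLikelihood Θ Q ν₀ p₀) (hpos : ∀ θ ∈ Θ, ∀ x, 0 < p₀ θ x)
    (h : IsLikelihood Θ Q ν p) :
    ∀ᵐ x ∂ν₀, ∃ c > 0, ∀ θ' ∈ Θ, p θ' x = c * p₀ θ' x := by
  have := h.sigmaFinite
  have := h₀.sigmaFinite
  have hac : ν₀ ≪ ν :=
    (h₀.dominating_absolutelyContinuous hθ hpos).trans (h.absolutelyContinuous hθ)
  -- The proportionality factor: it depends on the two dominating measures, not on the parameter.
  set r := ν₀.rnDeriv ν with hr
  have hrm : Measurable r := Measure.measurable_rnDeriv _ _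
  have heq : ∀ θ' ∈ Θ, ∀ᵐ x ∂ν, r x * ENNReal.ofReal (p₀ θ' x) = ENNReal.ofReal (p θ' x) := by
    intro θ' hθ'
    have hp := h.measurable θ' hθ'
    have hp₀ := h₀.measurable θ' hθ'
    have h1 : ν.withDensity (r * fun x => ENNReal.ofReal (p₀ θ' x)) =
        ν.withDensity (fun x => ENNReal.ofReal (p θ' x)) := by
      rw [withDensity_mul _ hrm (by fun_prop), hr, Measure.withDensity_rnDeriv_eq _ _ hac,
        ← h₀.law_eq θ' hθ', h.law_eq θ' hθ']
    exact (withDensity_eq_iff_of_sigmaFinite (by fun_prop) (by fun_prop)).1 h1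
  -- The null set in `heq` depends on the parameter. A countable dense subset leaves a single null
  -- set, and continuity in the parameter extends the identity to `Θ`.
  obtain ⟨C, hCΘ, hC, hΘC⟩ :=
    (TopologicalSpace.IsSeparable.of_separableSpace Θ).exists_countable_dense_subset
  have hall := (ae_ball_iff hC).2 fun θ' hθ' => heq θ' (hCΘ hθ')
  filter_upwards [hac.ae_le hall, hac.ae_le h.differentiable, h₀.differentiable,
    hac.ae_le (Measure.rnDeriv_lt_top ν₀ ν), Measure.rnDeriv_pos hac]
    with x hx hd hd₀ hlt hrpos
  refine ⟨(r x).toReal, ENNReal.toReal_pos hrpos.ne' hlt.ne, fun θ' hθ' => ?_⟩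
  have hEq : Set.EqOn (fun θ => p θ x) (fun θ => (r x).toReal * p₀ θ x) C := by
    intro θ'' hθ''
    have := congrArg ENNReal.toReal (hx θ'' hθ'')
    rw [ENNReal.toReal_mul, ENNReal.toReal_ofReal (hpos _ (hCΘ hθ'') x).le,
      ENNReal.toReal_ofReal (h.nonneg _ (hCΘ hθ'') x)] at this
    exact this.symm
  exact hEq.of_subset_closure hd.continuousOn (hd₀.continuousOn.const_mul _) hCΘ hΘC hθ'

/-- The logarithm turns the parameter-free factor into an additive constant, which differentiation
removes. -/
lemma IsLikelihood.score_ae_eq (hΘ : IsOpen Θ) (hθ : θ ∈ Θ)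
    (h₀ : IsLikelihood Θ Q ν₀ p₀) (hpos : ∀ θ ∈ Θ, ∀ x, 0 < p₀ θ x)
    (h : IsLikelihood Θ Q ν p) :
    ∀ᵐ x ∂(Q θ), ∀ i, score p θ i x = score p₀ θ i x := by
  filter_upwards [(h₀.absolutelyContinuous hθ).ae_le (h₀.ae_proportional hθ hpos h)]
    with x ⟨c, hc, hx⟩ i
  have : (fun θ' => Real.log (p θ' x)) =ᶠ[𝓝 θ] fun θ' => Real.log c + Real.log (p₀ θ' x) := by
    filter_upwards [hΘ.mem_nhds hθ] with θ' hθ'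
    rw [hx θ' hθ', Real.log_mul hc.ne' (hpos θ' hθ' x).ne']
  rw [score, score, this.fderiv_eq, fderiv_const_add]

/-- The score is an almost everywhere limit of the difference quotients `n (log p (θ + e/n) - log p
θ)`. -/
lemma IsLikelihood.aestronglyMeasurable_score (hΘ : IsOpen Θ) (hθ : θ ∈ Θ)
    (h : IsLikelihood Θ Q ν p) (hpos : ∀ θ ∈ Θ, ∀ x, 0 < p θ x) (i : Fin K) :
    AEStronglyMeasurable (score p θ i) ν := by
  classical
  set e : EuclideanSpace ℝ (Fin K) := EuclideanSpace.single i 1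
  let c : ℕ → ℝ := fun n => n
  have hc : Filter.Tendsto (fun n => ‖c n‖) Filter.atTop Filter.atTop := by
    simpa [c] using tendsto_natCast_atTop_atTop (R := ℝ)
  have hmem : ∀ᶠ n in Filter.atTop, θ + (c n)⁻¹ • e ∈ Θ := by
    have : Filter.Tendsto (fun n => θ + (c n)⁻¹ • e) Filter.atTop (𝓝 (θ + (0 : ℝ) • e)) :=
      tendsto_const_nhds.add ((tendsto_inv_atTop_nhds_zero_nat (𝕜 := ℝ)).smul_const e)
    rw [zero_smul, add_zero] at this
    exact this.eventually (hΘ.mem_nhds hθ)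
  -- For small `n` the shifted point may leave `Θ`, where `p` need not be measurable; the value `0`
  -- there does not affect the limit.
  refine aestronglyMeasurable_of_tendsto_ae Filter.atTop
    (f := fun n x => if θ + (c n)⁻¹ • e ∈ Θ then
      c n • (Real.log (p (θ + (c n)⁻¹ • e) x) - Real.log (p θ x)) else 0) (fun n => ?_) ?_
  · split_ifs with hn
    · have h1 := h.measurable _ hn
      have h2 := h.measurable _ hθ
      exact (by fun_prop : Measurable _).aestronglyMeasurable
    · exact aestronglyMeasurable_const
  · filter_upwards [h.differentiable] with x hx
    have hd : DifferentiableAt ℝ (fun θ' => Real.log (p θ' x)) θ :=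
      (hx.differentiableAt (hΘ.mem_nhds hθ)).log (hpos θ hθ x).ne'
    refine (hd.hasFDerivAt.lim e hc).congr' ?_
    filter_upwards [hmem] with n hn
    rw [if_pos hn]

/-- The Fisher information may be computed with any positive likelihood. -/
theorem IsLikelihood.hasFisherInformation_iff (hΘ : IsOpen Θ) (hθ : θ ∈ Θ)
    (h : IsLikelihood Θ Q ν p) (hpos : ∀ θ ∈ Θ, ∀ x, 0 < p θ x)
    (A : Matrix (Fin K) (Fin K) ℝ) :
    HasFisherInformation Θ Q θ A ↔
      ∀ i j, Integrable (fun x => score p θ i x * score p θ j x) (Q θ) ∧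
        A i j = ∫ x, score p θ i x * score p θ j x ∂(Q θ) := by
  refine ⟨?_, fun hA => ⟨ν, p, h, hA⟩⟩
  rintro ⟨ν', p', h', hA⟩ i j
  have heq : (fun x => score p' θ i x * score p' θ j x) =ᵐ[Q θ]
      fun x => score p θ i x * score p θ j x := by
    filter_upwards [h.score_ae_eq hΘ hθ hpos h'] with x hx
    rw [hx, hx]
  exact ⟨(hA i j).1.congr heq, (hA i j).2.trans (integral_congr_ae heq)⟩

omit [MeasurableSpace 𝓨] in
-- Needed because the image of the grid law is identified with the three-price law only for
-- parameters in `Θ`, where the impact functions are measurable.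
lemma hasFisherInformation_congr {Q' : EuclideanSpace ℝ (Fin K) → Measure 𝓧}
    (hQ : ∀ θ ∈ Θ, Q θ = Q' θ) (hθ : θ ∈ Θ) (A : Matrix (Fin K) (Fin K) ℝ) :
    HasFisherInformation Θ Q θ A ↔ HasFisherInformation Θ Q' θ A := by
  have key {ν : Measure 𝓧} {p} : IsLikelihood Θ Q ν p ↔ IsLikelihood Θ Q' ν p :=
    ⟨fun h => ⟨h.1, h.2, h.3, fun θ hθ => hQ θ hθ ▸ h.4 θ hθ, h.5⟩,
      fun h => ⟨h.1, h.2, h.3, fun θ hθ => (hQ θ hθ).symm ▸ h.4 θ hθ, h.5⟩⟩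
  simp only [HasFisherInformation, key, hQ θ hθ]

/-! ### Sufficient statistics -/

section Sufficiency

variable {s : 𝓧 → 𝓨} {q : EuclideanSpace ℝ (Fin K) → 𝓨 → ℝ}

lemma isLikelihood_comp [IsFiniteMeasure ν] (hs : Measurable s)
    (hq : ∀ θ ∈ Θ, Measurable (q θ)) (hpos : ∀ θ ∈ Θ, ∀ y, 0 < q θ y)
    (hdiff : ∀ᵐ y ∂(ν.map s), DifferentiableOn ℝ (fun θ => q θ y) Θ)
    (hQ : ∀ θ ∈ Θ, Q θ = ν.withDensity (fun x => ENNReal.ofReal (q θ (s x)))) :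
    IsLikelihood Θ Q ν (fun θ x => q θ (s x)) where
  sigmaFinite := inferInstance
  measurable θ hθ := (hq θ hθ).comp hs
  nonneg θ hθ _ := (hpos θ hθ _).le
  law_eq := hQ
  differentiable := ae_of_ae_map hs.aemeasurable hdiff

/-- Change of variables in the factorised density. Finiteness of `ν` passes to the image, whereas
`σ`-finiteness might not. -/
lemma isLikelihood_map [IsFiniteMeasure ν] (hs : Measurable s)
    (hq : ∀ θ ∈ Θ, Measurable (q θ)) (hpos : ∀ θ ∈ Θ, ∀ y, 0 < q θ y)
    (hdiff : ∀ᵐ y ∂(ν.map s), DifferentiableOn ℝ (fun θ => q θ y) Θ)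
    (hQ : ∀ θ ∈ Θ, Q θ = ν.withDensity (fun x => ENNReal.ofReal (q θ (s x)))) :
    IsLikelihood Θ (fun θ => (Q θ).map s) (ν.map s) q where
  sigmaFinite := inferInstance
  measurable := hq
  nonneg θ hθ y := (hpos θ hθ y).le
  law_eq θ hθ := by
    have hm : Measurable fun y => ENNReal.ofReal (q θ y) := (hq θ hθ).ennreal_ofReal
    ext B hB
    rw [Measure.map_apply hs hB, hQ θ hθ, withDensity_apply _ (hs hB), withDensity_apply _ hB,
      setLIntegral_map hB hm hs]
  differentiable := hdiff

/-- A statistic `s` through which the likelihood factors carries the whole Fisher information. -/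
theorem hasFisherInformation_map_iff [IsFiniteMeasure ν] (hΘ : IsOpen Θ) (hθ : θ ∈ Θ)
    (hs : Measurable s)
    (hq : ∀ θ ∈ Θ, Measurable (q θ)) (hpos : ∀ θ ∈ Θ, ∀ y, 0 < q θ y)
    (hdiff : ∀ᵐ y ∂(ν.map s), DifferentiableOn ℝ (fun θ => q θ y) Θ)
    (hQ : ∀ θ ∈ Θ, Q θ = ν.withDensity (fun x => ENNReal.ofReal (q θ (s x))))
    (A : Matrix (Fin K) (Fin K) ℝ) :
    HasFisherInformation Θ Q θ A ↔ HasFisherInformation Θ (fun θ => (Q θ).map s) θ A := by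
  have h₂ := isLikelihood_map hs hq hpos hdiff hQ
  rw [(isLikelihood_comp hs hq hpos hdiff hQ).hasFisherInformation_iff hΘ hθ
    (fun θ hθ x => hpos θ hθ (s x)), h₂.hasFisherInformation_iff hΘ hθ hpos]
  refine forall_congr' fun i => forall_congr' fun j => ?_
  have hm : AEStronglyMeasurable (fun y => score q θ i y * score q θ j y) ((Q θ).map s) :=
    ((h₂.aestronglyMeasurable_score hΘ hθ hpos i).mul
      (h₂.aestronglyMeasurable_score hΘ hθ hpos j)).mono_ac (h₂.absolutelyContinuous hθ)
  rw [integrable_map_measure hm hs.aemeasurable, integral_map hs.aemeasurable hm]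
  -- Only the parameter is differentiated, so the score of the composite is the score of `q`
  -- composed with `s`.
  rfl

end Sufficiency

lemma HasFisherInformation.unique (hΘ : IsOpen Θ) (hθ : θ ∈ Θ)
    (h : IsLikelihood Θ Q ν p) (hpos : ∀ θ ∈ Θ, ∀ x, 0 < p θ x)
    {A B : Matrix (Fin K) (Fin K) ℝ} (hA : HasFisherInformation Θ Q θ A)
    (hB : HasFisherInformation Θ Q θ B) : A = B := by
  rw [h.hasFisherInformation_iff hΘ hθ hpos] at hA hB
  ext i j
  rw [(hA i j).2, (hB i j).2]

/-- The Fisher information exists as soon as the score is square integrable. -/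
lemma IsLikelihood.exists_hasFisherInformation (h : IsLikelihood Θ Q ν p)
    (hL2 : ∀ i, MemLp (score p θ i) 2 (Q θ)) :
    ∃ A, HasFisherInformation Θ Q θ A :=
  ⟨fun i j => ∫ x, score p θ i x * score p θ j x ∂(Q θ), ν, p, h,
    fun i j => ⟨(hL2 i).integrable_mul (hL2 j), rfl⟩⟩

end Fisher

/-! ## Brownian motion: measurable modification and Cameron–Martin shifts -/

section Brownian

variable {Ω : Type*} [MeasurableSpace Ω] {P : Measure Ω} {W : ℝ≥0 → Ω → ℝ}

/-- Prices are sampled at times depending on the random `T`, which calls for joint measurability and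
for agreement at all times simultaneously. -/
lemma ProbabilityTheory.IsBrownianReal.exists_measurable_modification (hW : IsBrownianReal W P) :
    ∃ W' : ℝ≥0 → Ω → ℝ, IsPreBrownianReal W' P ∧ Measurable (Function.uncurry W') ∧
      ∀ᵐ ω ∂P, ∀ t, W t ω = W' t ω := by
  classical
  obtain ⟨D, hD, hDd⟩ := TopologicalSpace.exists_countable_dense ℝ≥0
  let V : ℝ≥0 → Ω → ℝ := fun t => (hW.aemeasurable t).mk
  have hV : ∀ t, Measurable (V t) := fun t => (hW.aemeasurable t).measurable_mk
  have hgood : ∀ᵐ ω ∂P, Continuous (W · ω) ∧ ∀ t ∈ D, W t ω = V t ω :=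
    hW.cont.and ((ae_ball_iff hD).2 fun t _ => (hW.aemeasurable t).ae_eq_mk)
  obtain ⟨S, hSsub, hSm, hS⟩ := hgood.exists_measurable_mem
  -- Off a measurable set of full measure the path is replaced by `0`, so every path is continuous.
  -- Measurability is clear at times in `D`, through `V`, and passes to limits.
  let W' : ℝ≥0 → Ω → ℝ := fun t ω => if ω ∈ S then W t ω else 0
  have hcont : ∀ ω, Continuous fun t => W' t ω := by
    intro ω
    by_cases hω : ω ∈ S
    · simpa only [W', if_pos hω] using (hS ω hω).1
    · simpa only [W', if_neg hω] using continuous_const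
  have hmD : ∀ t ∈ D, Measurable (W' t) := by
    intro t ht
    have : W' t = fun ω => if ω ∈ S then V t ω else 0 := by
      funext ω
      by_cases hω : ω ∈ S
      · simp only [W', if_pos hω, (hS ω hω).2 t ht]
      · simp only [W', if_neg hω]
    rw [this]
    exact Measurable.ite hSm (hV t) measurable_const
  have hm : ∀ t, Measurable (W' t) := by
    intro t
    obtain ⟨u, huD, hu⟩ := mem_closure_iff_seq_limit.1 (hDd.closure_eq ▸ Set.mem_univ t)
    refine measurable_of_tendsto_metrizable (fun n => hmD (u n) (huD n)) ?_
    exact tendsto_pi_nhds.2 fun ω => ((hcont ω).tendsto t).comp hu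
  have hae : ∀ᵐ ω ∂P, ∀ t, W t ω = W' t ω := by
    filter_upwards [hSsub] with ω hω t
    simp only [W', if_pos hω]
  refine ⟨W', hW.toIsPreBrownianReal.congr fun t => hae.mono fun ω h => h t, ?_, hae⟩
  exact measurable_uncurry_of_continuous_of_measurable hcont hm

lemma ProbabilityTheory.IsPreBrownianReal.hasGaussianLaw_pi (hW : IsPreBrownianReal W P) {m : ℕ}
    (t : Fin m → ℝ≥0) (σ : ℝ) : HasGaussianLaw (fun ω k => σ * W (t k) ω) P := by
  have h := (hW.isGaussianProcess.comp_right t).hasGaussianLaw Finset.univ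
  let L : (↥(Finset.univ : Finset (Fin m)) → ℝ) →L[ℝ] (Fin m → ℝ) :=
    ContinuousLinearMap.pi fun k => σ • ContinuousLinearMap.proj ⟨k, Finset.mem_univ k⟩
  exact h.map L

/-- Cameron–Martin formula for finitely many values of a Brownian motion. -/
theorem ProbabilityTheory.IsPreBrownianReal.map_add_eq_withDensity (hW : IsPreBrownianReal W P) {m : ℕ}
    (t : Fin m → ℝ≥0) (σ : ℝ) (a b : Fin m → ℝ)
    (hb : ∀ k, b k = σ ^ 2 * ∑ j, a j * min (t k : ℝ) (t j)) :
    P.map (fun ω k => b k + σ * W (t k) ω) =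
      (P.map (fun ω k => σ * W (t k) ω)).withDensity
        (fun x => ENNReal.ofReal (Real.exp (∑ j, a j * x j - (∑ j, a j * b j) / 2))) := by
  have hG := hW.hasGaussianLaw_pi t σ
  have hP : IsProbabilityMeasure P := hG.isProbabilityMeasure
  have hXm : AEMeasurable (fun ω k => σ * W (t k) ω) P := hG.aemeasurable
  set μ := P.map (fun ω k => σ * W (t k) ω) with hμ
  have : IsGaussian μ := hG.isGaussian_map
  have h2 (k : Fin m) : MemLp (fun x : Fin m → ℝ => x k) 2 μ :=
    ((IsGaussian.hasGaussianLaw_id (μ := μ)).map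
      (ContinuousLinearMap.proj (R := ℝ) (φ := fun _ : Fin m => ℝ) k)).memLp_two
  have hcoord (k j : Fin m) : cov[fun x : Fin m → ℝ => x k, fun x => x j; μ] =
      σ ^ 2 * min (t k : ℝ) (t j) := by
    rw [hμ, covariance_map (measurable_pi_apply k).aestronglyMeasurable
      (measurable_pi_apply j).aestronglyMeasurable hXm]
    simp only [Function.comp_def]
    rw [covariance_const_mul_left, covariance_const_mul_right, hW.covariance_fun_eval]
    push_cast
    ring
  have hmean (k : Fin m) : ∫ x : Fin m → ℝ, x k ∂μ = 0 := by
    rw [hμ, integral_map hXm (measurable_pi_apply k).aestronglyMeasurable,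
      integral_const_mul, hW.integral_eval, mul_zero]
  let L : StrongDual ℝ (Fin m → ℝ) := ∑ j, a j • ContinuousLinearMap.proj j
  have hLx (x : Fin m → ℝ) : L x = ∑ j, a j * x j := by simp [L]
  have hexpand (L' : StrongDual ℝ (Fin m → ℝ)) (x : Fin m → ℝ) :
      L' x = ∑ k, L' (Pi.single k 1) * x k := by
    conv_lhs => rw [pi_eq_sum_univ' x]
    simp [mul_comm]
  -- By `hb`, `b` is the covariance matrix applied to `a`, that is, the vector representing the
  -- covariance with `L`.
  have hcov (L' : StrongDual ℝ (Fin m → ℝ)) : L' b = cov[L', L; μ] := by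
    have e1 : (⇑L' : (Fin m → ℝ) → ℝ) = fun x => ∑ k, L' (Pi.single k 1) * x k :=
      funext (hexpand L')
    have e2 : (⇑L : (Fin m → ℝ) → ℝ) = fun x => ∑ j, a j * x j := funext hLx
    rw [e2]
    conv_rhs => rw [e1]
    rw [covariance_fun_sum_fun_sum (fun k => (h2 k).const_mul _) (fun j => (h2 j).const_mul _),
      hexpand L' b]
    refine Finset.sum_congr rfl fun k _ => ?_
    rw [hb k, Finset.mul_sum, Finset.mul_sum]
    refine Finset.sum_congr rfl fun j _ => ?_
    rw [covariance_const_mul_left, covariance_const_mul_right, hcoord]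
    ring
  have hvar : Var[L; μ] = ∑ j, a j * b j := by
    rw [← covariance_self (by fun_prop), ← hcov L, hLx]
  have hint : ∫ x, L x ∂μ = 0 := by
    simp_rw [hLx]
    rw [integral_finsetSum _ fun j _ => ((h2 j).integrable (by norm_num)).const_mul _]
    simp [integral_const_mul, hmean]
  have key := map_add_eq_withDensity_exp (μ := μ) L b hcov
  rw [hint, hvar, hμ, AEMeasurable.map_map_of_aemeasurable (by fun_prop) hXm] at key
  simp only [hLx, sub_zero] at key
  rw [← key]
  congr 1
  funext ω k
  simp [add_comm]

end Brownian

/-- Conditional densities glue to a joint density by Tonelli, since `z` has the same law `G` under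
both maps. -/
lemma map_prodMk_eq_withDensity {Z Ω X : Type*} [MeasurableSpace Z] [MeasurableSpace Ω]
    [MeasurableSpace X] {G : Measure Z} {P : Measure Ω} [SFinite G] [SFinite P]
    {F F₀ : Z × Ω → X} {d : Z × X → ℝ≥0∞} (hF : Measurable F) (hF₀ : Measurable F₀)
    (hd : Measurable d)
    (h : ∀ᵐ z ∂G, P.map (fun ω => F (z, ω)) =
      (P.map fun ω => F₀ (z, ω)).withDensity fun x => d (z, x)) :
    (G.prod P).map (fun y => (y.1, F y)) =
      ((G.prod P).map fun y => (y.1, F₀ y)).withDensity d := by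
  have hm : Measurable fun y : Z × Ω => (y.1, F y) := by fun_prop
  have hm₀ : Measurable fun y : Z × Ω => (y.1, F₀ y) := by fun_prop
  ext B hB
  rw [Measure.map_apply hm hB, Measure.prod_apply (hm hB), withDensity_apply _ hB,
    setLIntegral_map hB hd hm₀, ← lintegral_indicator (hm₀ hB)]
  have hi : Measurable (((fun y : Z × Ω => (y.1, F₀ y)) ⁻¹' B).indicator
      fun y => d (y.1, F₀ y)) := (hd.comp hm₀).indicator (hm₀ hB)
  rw [lintegral_prod _ hi.aemeasurable]
  refine lintegral_congr_ae ?_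
  filter_upwards [h] with z hz
  have hBz : MeasurableSet (Prod.mk z ⁻¹' B) := measurable_prodMk_left hB
  have hFz : Measurable fun ω => F (z, ω) := by fun_prop
  have hF₀z : Measurable fun ω => F₀ (z, ω) := by fun_prop
  have h1 := congrArg (fun μ => μ (Prod.mk z ⁻¹' B)) hz
  rw [Measure.map_apply hFz hBz, withDensity_apply _ hBz,
    setLIntegral_map hBz (by fun_prop) hF₀z, ← lintegral_indicator (hF₀z hBz)] at h1
  exact h1

/-! ## The likelihood of the Almgren–Chriss model -/

section Price

variable {S₀ σ : ℝ} {g h : ℝ → ℝ} {v T t : ℝ} {w : ℝ≥0 → ℝ}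

lemma almgrenChrissPrice_of_le (hS₀ : S₀ ≠ 0) (ht : t ≤ T) :
    almgrenChrissPrice S₀ σ g h v T w t = g v * t + h v + σ * w t.toNNReal := by
  rw [almgrenChrissPrice, almgrenChrissStock, if_pos ht]
  field_simp
  ring

lemma almgrenChrissPrice_of_lt (hS₀ : S₀ ≠ 0) (ht : T < t) :
    almgrenChrissPrice S₀ σ g h v T w t = g v * T + σ * w t.toNNReal := by
  rw [almgrenChrissPrice, almgrenChrissStock, if_neg ht.not_ge]
  field_simp
  ring

lemma almgrenChrissPrice_zero (hS₀ : S₀ ≠ 0) :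
    almgrenChrissPrice S₀ σ 0 0 v T w t = σ * w t.toNNReal := by
  rcases le_or_gt t T with ht | ht
  · simp [almgrenChrissPrice_of_le hS₀ ht]
  · simp [almgrenChrissPrice_of_lt hS₀ ht]

lemma measurable_almgrenChrissPrice {Ω : Type*} [MeasurableSpace Ω] {W : ℝ≥0 → Ω → ℝ}
    (hW : Measurable (Function.uncurry W)) (hg : Measurable g) (hh : Measurable h)
    {u : ℝ → ℝ} (hu : Measurable u) :
    Measurable fun y : (ℝ × ℝ) × Ω =>
      almgrenChrissPrice S₀ σ g h y.1.1 y.1.2 (fun t => W t y.2) (u y.1.2) := by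
  have hWu : Measurable fun y : (ℝ × ℝ) × Ω => W (u y.1.2).toNNReal y.2 :=
    hW.comp (g := Function.uncurry W)
      (f := fun y : (ℝ × ℝ) × Ω => ((u y.1.2).toNNReal, y.2)) (by fun_prop)
  have hset : MeasurableSet {y : (ℝ × ℝ) × Ω | u y.1.2 ≤ y.1.2} :=
    measurableSet_le (by fun_prop) (by fun_prop)
  unfold almgrenChrissPrice almgrenChrissStock
  exact ((Measurable.ite hset (by fun_prop) (by fun_prop)).sub_const _).div_const _

end Price

@[simp] lemma gridTimes_castSucc {n : ℕ} (τ : Fin n → ℝ) (δ T : ℝ) (i : Fin n) :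
    gridTimes τ δ T i.castSucc = τ i * T := by simp [gridTimes]

@[simp] lemma gridTimes_last {n : ℕ} (τ : Fin n → ℝ) (δ T : ℝ) :
    gridTimes τ δ T (Fin.last n) = T + δ := by simp [gridTimes]

lemma measurable_gridTimes {n : ℕ} (τ : Fin n → ℝ) (δ : ℝ) (k : Fin (n + 1)) :
    Measurable fun T => gridTimes τ δ T k := by
  refine Fin.lastCases ?_ (fun i => ?_) k
  · simp only [gridTimes_last]; fun_prop
  · simp only [gridTimes_castSucc]; fun_prop

/-- The log-likelihood ratio of the impact levels `γ` (permanent) and `η` (temporary) against zero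
impact, given the prices `y 0`, `y 1`, `y 2` at the times `τ₁ T`, `T` and `T + δ`. -/
noncomputable def impactLogLikelihood (σ τ₁ δ γ η T : ℝ) (y : Fin 3 → ℝ) : ℝ :=
  (η / (τ₁ * T) * y 0 + (γ + η / δ) * y 1 - η / δ * y 2
    - (γ ^ 2 * T + 2 * γ * η + η ^ 2 * (1 / (τ₁ * T) + 1 / δ)) / 2) / σ ^ 2

/-- The first and the last trajectory price, and the price after the execution. -/
def endpointPrices {n : ℕ} (x : (ℝ × ℝ) × (Fin (n + 2) → ℝ)) : (ℝ × ℝ) × (Fin 3 → ℝ) :=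
  (x.1, ![x.2 0, x.2 (Fin.last n).castSucc, x.2 (Fin.last (n + 1))])

lemma measurable_endpointPrices {n : ℕ} : Measurable (endpointPrices (n := n)) := by
  refine Measurable.prodMk measurable_fst (measurable_pi_lambda _ fun k => ?_)
  fin_cases k <;> simp <;> fun_prop

/-- The likelihood of the impact functions given the order and three prices. -/
noncomputable def impactLikelihood (σ τ₁ δ : ℝ) (g h : ℝ → ℝ)
    (y : (ℝ × ℝ) × (Fin 3 → ℝ)) : ℝ :=
  Real.exp (impactLogLikelihood σ τ₁ δ (g y.1.1) (h y.1.1) y.1.2 y.2)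

lemma measurable_impactLikelihood {σ τ₁ δ : ℝ} {g h : ℝ → ℝ} (hg : Measurable g)
    (hh : Measurable h) : Measurable (impactLikelihood σ τ₁ δ g h) := by
  unfold impactLikelihood impactLogLikelihood
  fun_prop

section Law

variable {Ω : Type*} [MeasurableSpace Ω] {P : Measure Ω} {W : ℝ≥0 → Ω → ℝ}

lemma measurable_gridPrices (hW : Measurable (Function.uncurry W)) {S₀ σ : ℝ} {g h : ℝ → ℝ}
    (hg : Measurable g) (hh : Measurable h) {n : ℕ} (τ : Fin n → ℝ) (δ : ℝ) :
    Measurable fun (y : (ℝ × ℝ) × Ω) (k : Fin (n + 1)) =>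
      almgrenChrissPrice S₀ σ g h y.1.1 y.1.2 (fun t => W t y.2) (gridTimes τ δ y.1.2 k) :=
  measurable_pi_lambda _ fun k =>
    measurable_almgrenChrissPrice hW hg hh (measurable_gridTimes τ δ k)

lemma almgrenChrissLaw_congr {W' : ℝ≥0 → Ω → ℝ} (hae : ∀ᵐ ω ∂P, ∀ t, W t ω = W' t ω)
    (G : Measure (ℝ × ℝ)) [SFinite P] (S₀ σ : ℝ) (g h : ℝ → ℝ) {m : ℕ} (times : ℝ → Fin m → ℝ) :
    almgrenChrissLaw P W G S₀ σ g h times = almgrenChrissLaw P W' G S₀ σ g h times := by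
  refine Measure.map_congr ?_
  filter_upwards [Measure.quasiMeasurePreserving_snd.ae hae] with y hy
  simp only [hy]

lemma map_endpointPrices_almgrenChrissLaw (hW : Measurable (Function.uncurry W))
    (G : Measure (ℝ × ℝ)) (S₀ σ : ℝ) {g h : ℝ → ℝ} (hg : Measurable g) (hh : Measurable h)
    {n : ℕ} {τ : Fin (n + 1) → ℝ} (hτ_last : τ (Fin.last n) = 1) (δ : ℝ) :
    (almgrenChrissLaw P W G S₀ σ g h (gridTimes τ δ)).map endpointPrices =
      almgrenChrissLaw P W G S₀ σ g h (threeTimes (τ 0) δ) := by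
  rw [almgrenChrissLaw, Measure.map_map measurable_endpointPrices
    (measurable_fst.prodMk (measurable_gridPrices hW hg hh τ δ)), almgrenChrissLaw]
  congr 1
  funext y
  refine Prod.ext rfl (funext fun k => ?_)
  have h0 : gridTimes τ δ y.1.2 0 = τ 0 * y.1.2 := gridTimes_castSucc τ δ y.1.2 0
  fin_cases k <;> simp [endpointPrices, threeTimes, h0, hτ_last]

/-- Given the order, the prices have the claimed likelihood ratio with respect to the prices
without impact, by the Cameron–Martin formula. -/
lemma map_gridPrices_eq_withDensity (hW : IsPreBrownianReal W P) {S₀ σ : ℝ} (hS₀ : S₀ ≠ 0)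
    (hσ : σ ≠ 0) (g h : ℝ → ℝ) (v : ℝ) {T : ℝ} (hT : 0 < T)
    {n : ℕ} {τ : Fin (n + 1) → ℝ} (hτ : StrictMono τ) (hτ_pos : 0 < τ 0)
    (hτ_last : τ (Fin.last n) = 1) {δ : ℝ} (hδ : 0 < δ) :
    P.map (fun ω k => almgrenChrissPrice S₀ σ g h v T (fun t => W t ω) (gridTimes τ δ T k)) =
      (P.map fun ω k =>
        almgrenChrissPrice S₀ σ 0 0 v T (fun t => W t ω) (gridTimes τ δ T k)).withDensity
        fun x => ENNReal.ofReal (impactLikelihood σ (τ 0) δ g h (endpointPrices ((v, T), x))) := by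
  set γ := g v with hγ
  set η := h v with hη
  let b : Fin (n + 2) → ℝ := Fin.snoc (α := fun _ => ℝ) (fun i => γ * (τ i * T) + η) (γ * T)
  have hb_cast (i : Fin (n + 1)) : b i.castSucc = γ * (τ i * T) + η := by simp [b]
  have hb_last : b (Fin.last (n + 1)) = γ * T := by simp [b]
  -- The coefficients of the mean on the covariance columns at `τ 0 * T`, `T` and `T + δ`. Summing
  -- `Pi.single`s also covers `n = 0`, where the first two indices coincide and their coefficients
  -- add up.
  let a : Fin (n + 2) → ℝ := fun j =>
    ((Pi.single 0 (η / (τ 0 * T)) : Fin (n + 2) → ℝ) j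
      + (Pi.single (Fin.last n).castSucc (γ + η / δ) : Fin (n + 2) → ℝ) j
      + (Pi.single (Fin.last (n + 1)) (-(η / δ)) : Fin (n + 2) → ℝ) j) / σ ^ 2
  have hsum (f : Fin (n + 2) → ℝ) : ∑ j, a j * f j =
      (η / (τ 0 * T) * f 0 + (γ + η / δ) * f (Fin.last n).castSucc
        - η / δ * f (Fin.last (n + 1))) / σ ^ 2 := by
    simp only [a, div_mul_eq_mul_div, ← Finset.sum_div, add_mul, Finset.sum_add_distrib,
      Pi.single_apply, ite_mul, zero_mul, Finset.sum_ite_eq', Finset.mem_univ, if_true]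
    ring
  have hτ_le (i : Fin (n + 1)) : τ i ≤ 1 := hτ_last ▸ hτ.monotone (Fin.le_last i)
  have hτ_ge (i : Fin (n + 1)) : τ 0 ≤ τ i := hτ.monotone (Fin.zero_le i)
  have hgrid0 : gridTimes τ δ T 0 = τ 0 * T := gridTimes_castSucc τ δ T 0
  have hb0 : b 0 = γ * (τ 0 * T) + η := hb_cast 0
  have htime (k : Fin (n + 2)) : ((gridTimes τ δ T k).toNNReal : ℝ) = gridTimes τ δ T k := by
    refine Real.coe_toNNReal _ ?_
    refine Fin.lastCases ?_ (fun i => ?_) k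
    · rw [gridTimes_last]; positivity
    · rw [gridTimes_castSucc]; exact mul_nonneg (hτ_pos.le.trans (hτ_ge i)) hT.le
  have hprice (ω : Ω) (k : Fin (n + 2)) :
      almgrenChrissPrice S₀ σ g h v T (fun t => W t ω) (gridTimes τ δ T k) =
        b k + σ * W (gridTimes τ δ T k).toNNReal ω := by
    refine Fin.lastCases ?_ (fun i => ?_) k
    · rw [hb_last, almgrenChrissPrice_of_lt hS₀ (by rw [gridTimes_last]; linarith)]
    · rw [hb_cast, almgrenChrissPrice_of_le hS₀ (by
        rw [gridTimes_castSucc]; exact mul_le_of_le_one_left hT.le (hτ_le i)), gridTimes_castSucc]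
  have hb (k : Fin (n + 2)) : b k = σ ^ 2 * ∑ j, a j *
      min ((gridTimes τ δ T k).toNNReal : ℝ) ((gridTimes τ δ T j).toNNReal : ℝ) := by
    simp only [htime]
    rw [hsum, hgrid0, gridTimes_castSucc, gridTimes_last, hτ_last, one_mul]
    refine Fin.lastCases ?_ (fun i => ?_) k
    · have h1 : τ 0 * T ≤ T := mul_le_of_le_one_left hT.le (hτ_le 0)
      rw [hb_last, gridTimes_last, min_eq_right (by linarith), min_eq_right (by linarith), min_self]
      field_simp
      ring
    · have h1 : τ i * T ≤ T := mul_le_of_le_one_left hT.le (hτ_le i)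
      have h2 : τ 0 * T ≤ τ i * T := mul_le_mul_of_nonneg_right (hτ_ge i) hT.le
      rw [hb_cast, gridTimes_castSucc, min_eq_right h2, min_eq_left h1,
        min_eq_left (by linarith)]
      field_simp
      ring
  simp only [hprice, almgrenChrissPrice_zero hS₀]
  rw [hW.map_add_eq_withDensity _ σ a b hb]
  congr 1
  funext x
  rw [hsum, hsum, hb0, hb_cast, hb_last, hτ_last]
  simp only [impactLikelihood, impactLogLikelihood, endpointPrices, ← hγ, ← hη]
  congr 2
  simp
  field_simp
  ring

theorem almgrenChrissLaw_eq_withDensity [IsFiniteMeasure P] (hW : IsPreBrownianReal W P)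
    (hWm : Measurable (Function.uncurry W)) {G : Measure (ℝ × ℝ)} [IsFiniteMeasure G]
    (hG : ∀ᵐ z ∂G, 0 < z.2) {S₀ σ : ℝ} (hS₀ : S₀ ≠ 0) (hσ : σ ≠ 0) {g h : ℝ → ℝ}
    (hg : Measurable g) (hh : Measurable h)
    {n : ℕ} {τ : Fin (n + 1) → ℝ} (hτ : StrictMono τ) (hτ_pos : 0 < τ 0)
    (hτ_last : τ (Fin.last n) = 1) {δ : ℝ} (hδ : 0 < δ) :
    almgrenChrissLaw P W G S₀ σ g h (gridTimes τ δ) =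
      (almgrenChrissLaw P W G S₀ σ 0 0 (gridTimes τ δ)).withDensity
        fun x => ENNReal.ofReal (impactLikelihood σ (τ 0) δ g h (endpointPrices x)) := by
  refine map_prodMk_eq_withDensity (measurable_gridPrices hWm hg hh τ δ)
    (measurable_gridPrices hWm measurable_const measurable_const τ δ)
    ((measurable_impactLikelihood hg hh).comp measurable_endpointPrices).ennreal_ofReal ?_
  filter_upwards [hG] with z hz
  exact map_gridPrices_eq_withDensity hW hS₀ hσ g h z.1 hz hτ hτ_pos hτ_last hδ

end Law

/-! ## The score of the Almgren–Chriss model -/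

section Score

variable {K : ℕ} {g h : EuclideanSpace ℝ (Fin K) → ℝ → ℝ} {θ : EuclideanSpace ℝ (Fin K)}

/-- In this grouping both brackets are centred under the model: they become `σ W_T` and `σ
(W_{t₁}/t₁ + (W_T - W_{T+δ})/δ)`. -/
lemma score_impactLikelihood {σ τ₁ δ : ℝ} {y : (ℝ × ℝ) × (Fin 3 → ℝ)}
    (hg : DifferentiableAt ℝ (fun θ => g θ y.1.1) θ)
    (hh : DifferentiableAt ℝ (fun θ => h θ y.1.1) θ) (i : Fin K) :
    score (fun θ => impactLikelihood σ τ₁ δ (g θ) (h θ)) θ i y =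
      (fderiv ℝ (fun θ => g θ y.1.1) θ (EuclideanSpace.single i 1) *
          (y.2 1 - g θ y.1.1 * y.1.2 - h θ y.1.1)
        + fderiv ℝ (fun θ => h θ y.1.1) θ (EuclideanSpace.single i 1) *
          (1 / (τ₁ * y.1.2) * y.2 0 + 1 / δ * (y.2 1 - y.2 2) - g θ y.1.1
            - h θ y.1.1 * (1 / (τ₁ * y.1.2) + 1 / δ))) / σ ^ 2 := by
  have hg' := hg.hasFDerivAt
  have hh' := hh.hasFDerivAt
  -- Restriction to the line through `θ` along the `i`-th axis reduces the computation to
  -- one-variable derivatives.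
  have hline : ∀ {f : EuclideanSpace ℝ (Fin K) → ℝ} {f'}, HasFDerivAt f f' θ →
      HasDerivAt (fun t : ℝ => f (θ + t • EuclideanSpace.single i 1))
        (f' (EuclideanSpace.single i 1)) 0 := fun hf => hf.hasLineDerivAt _
  have hd : DifferentiableAt ℝ (fun θ' => impactLogLikelihood σ τ₁ δ (g θ' y.1.1) (h θ' y.1.1)
      y.1.2 y.2) θ := by
    unfold impactLogLikelihood
    simp only [div_eq_mul_inv]
    fun_prop
  have h1 := hline hd.hasFDerivAt
  simp only [score, impactLikelihood, Real.log_exp]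
  refine h1.unique ?_
  have hgl := hline hg'
  have hhl := hline hh'
  have key := ((((((hhl.div_const (τ₁ * y.1.2)).mul_const (y.2 0)).add
    ((hgl.add (hhl.div_const δ)).mul_const (y.2 1))).sub
    ((hhl.div_const δ).mul_const (y.2 2))).sub
    (((((hgl.pow 2).mul_const y.1.2).add ((hgl.const_mul 2).mul hhl)).add
      ((hhl.pow 2).mul_const (1 / (τ₁ * y.1.2) + 1 / δ))).div_const 2)).div_const (σ ^ 2))
  refine key.congr_deriv ?_
  simp only [zero_smul, add_zero]
  ring

lemma abs_fderiv_single_le {f : EuclideanSpace ℝ (Fin K) → ℝ} {L : ℝ}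
    {U : Set (EuclideanSpace ℝ (Fin K))} (hU : U ∈ 𝓝 θ)
    (hf : ∀ θ' ∈ U, ∀ θ'' ∈ U, |f θ' - f θ''| ≤ L * ‖θ' - θ''‖) (i : Fin K) :
    |fderiv ℝ f θ (EuclideanSpace.single i 1)| ≤ |L| := by
  have h1 : ‖fderiv ℝ f θ‖ ≤ |L| := by
    refine norm_fderiv_le_of_lip' ℝ (abs_nonneg L) ?_
    filter_upwards [hU] with x hx
    exact (hf x hx θ (mem_of_mem_nhds hU)).trans (by gcongr; exact le_abs_self L)
  have h2 := (fderiv ℝ f θ).le_opNorm (EuclideanSpace.single i 1)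
  rw [PiLp.norm_single, norm_one, mul_one] at h2
  exact h2.trans h1

end Score

/-! ### Square integrability of the score -/

section SquareIntegrability

variable {Ω : Type*} [MeasurableSpace Ω] {P : Measure Ω} {W : ℝ≥0 → Ω → ℝ}

/-- By independence and Fubini the second moment is the mean of the random time, which is at most
`M` times the mass of `G`. -/
lemma ProbabilityTheory.IsPreBrownianReal.memLp_two_random_time (hW : IsPreBrownianReal W P)
    (hWm : Measurable (Function.uncurry W)) {Z : Type*} [MeasurableSpace Z] {G : Measure Z}
    [IsFiniteMeasure G] {u : Z → ℝ≥0} (hu : Measurable u) {M : ℝ} (hM : ∀ᵐ z ∂G, (u z : ℝ) ≤ M) :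
    MemLp (fun y : Z × Ω => W (u y.1) y.2) 2 (G.prod P) := by
  have : IsProbabilityMeasure P := hW.isGaussianProcess.isProbabilityMeasure
  have hm : Measurable fun y : Z × Ω => W (u y.1) y.2 :=
    hWm.comp (g := Function.uncurry W) (f := fun y : Z × Ω => (u y.1, y.2)) (by fun_prop)
  have hsq (t : ℝ≥0) : ∫ ω, W t ω ^ 2 ∂P = t := by
    have h := hW.covariance_eval t t
    rw [covariance_self (hW.aemeasurable t), variance_of_integral_eq_zero (hW.aemeasurable t)
      (hW.integral_eval t), min_self] at h
    exact h
  have hint (t : ℝ≥0) : Integrable (fun ω => W t ω ^ 2) P :=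
    (hW.isGaussianProcess.hasGaussianLaw_eval t).memLp_two.integrable_sq
  rw [memLp_two_iff_integrable_sq hm.aestronglyMeasurable,
    integrable_prod_iff (hm.pow_const 2).aestronglyMeasurable]
  refine ⟨.of_forall fun z => hint (u z), ?_⟩
  simp only [norm_pow, Real.norm_eq_abs, sq_abs, hsq]
  refine Integrable.of_bound (C := M) (by fun_prop) ?_
  filter_upwards [hM] with z hz
  simpa using hz

lemma memLp_score_impactLikelihood {K : ℕ} {g h : EuclideanSpace ℝ (Fin K) → ℝ → ℝ}
    {θ : EuclideanSpace ℝ (Fin K)} (hW : IsPreBrownianReal W P)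
    (hWm : Measurable (Function.uncurry W)) {G : Measure (ℝ × ℝ)} [IsFiniteMeasure G]
    {T_L T_U : ℝ} (hT_L : 0 < T_L) (hG : ∀ᵐ z ∂G, T_L ≤ z.2 ∧ z.2 ≤ T_U)
    {S₀ σ : ℝ} (hS₀ : S₀ ≠ 0) (hσ : σ ≠ 0) (hg_meas : Measurable (g θ)) (hh_meas : Measurable (h θ))
    (hg : ∀ᵐ z ∂G, DifferentiableAt ℝ (fun θ => g θ z.1) θ)
    (hh : ∀ᵐ z ∂G, DifferentiableAt ℝ (fun θ => h θ z.1) θ)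
    {n : ℕ} {τ : Fin (n + 1) → ℝ} (hτ : StrictMono τ) (hτ_pos : 0 < τ 0)
    (hτ_last : τ (Fin.last n) = 1) {δ : ℝ} (hδ : 0 < δ) (i : Fin K) {L : ℝ}
    (hgL : ∀ᵐ z ∂G, |fderiv ℝ (fun θ => g θ z.1) θ (EuclideanSpace.single i 1)| ≤ |L|)
    (hhL : ∀ᵐ z ∂G, |fderiv ℝ (fun θ => h θ z.1) θ (EuclideanSpace.single i 1)| ≤ |L|)
    (hm : AEStronglyMeasurable
      (score (fun θ x => impactLikelihood σ (τ 0) δ (g θ) (h θ) (endpointPrices x)) θ i)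
      (almgrenChrissLaw P W G S₀ σ (g θ) (h θ) (gridTimes τ δ))) :
    MemLp (score (fun θ x => impactLikelihood σ (τ 0) δ (g θ) (h θ) (endpointPrices x)) θ i) 2
      (almgrenChrissLaw P W G S₀ σ (g θ) (h θ) (gridTimes τ δ)) := by
  have hF := measurable_fst.prodMk
    (measurable_gridPrices hWm (S₀ := S₀) (σ := σ) hg_meas hh_meas τ δ)
  have : IsProbabilityMeasure P := hW.isGaussianProcess.isProbabilityMeasure
  rw [almgrenChrissLaw] at hm ⊢
  rw [memLp_map_measure_iff hm hF.aemeasurable]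
  have hτ0 : τ 0 ≤ 1 := hτ_last ▸ hτ.monotone (Fin.zero_le _)
  have hB0 := hW.memLp_two_random_time hWm (G := G) (u := fun z => (τ 0 * z.2).toNNReal)
    (by fun_prop) (M := T_U) (by
      filter_upwards [hG] with z hz
      have hz0 : 0 ≤ z.2 := hT_L.le.trans hz.1
      rw [Real.coe_toNNReal _ (by positivity)]
      exact (mul_le_of_le_one_left hz0 hτ0).trans hz.2)
  have hB1 := hW.memLp_two_random_time hWm (G := G) (u := fun z => z.2.toNNReal)
    (by fun_prop) (M := T_U) (by
      filter_upwards [hG] with z hz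
      rw [Real.coe_toNNReal _ (hT_L.le.trans hz.1)]
      exact hz.2)
  have hB2 := hW.memLp_two_random_time hWm (G := G) (u := fun z => (z.2 + δ).toNNReal)
    (by fun_prop) (M := T_U + δ) (by
      filter_upwards [hG] with z hz
      rw [Real.coe_toNNReal _ (by linarith)]
      linarith [hz.2])
  -- The dominating function uses `T ≥ T_L` to bound `1/(τ 0 * T)` and `|L|` to bound both impact
  -- derivatives.
  have hdom := (((hB1.norm).add ((hB0.norm).const_mul (1 / (τ 0 * T_L)))).add
    (((hB1.norm).add hB2.norm).const_mul (1 / δ))).const_mul (|L| / |σ|)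
  refine hdom.mono' (hm.comp_aemeasurable hF.aemeasurable) ?_
  have hfst : ∀ {p : ℝ × ℝ → Prop}, (∀ᵐ z ∂G, p z) → ∀ᵐ y ∂(G.prod P), p y.1 :=
    fun hp => Measure.quasiMeasurePreserving_fst.ae hp
  filter_upwards [hfst hG, hfst hg, hfst hh, hfst hgL, hfst hhL] with y hy hgy hhy hgLy hhLy
  have hT : 0 < y.1.2 := hT_L.trans_le hy.1
  have hgrid0 : gridTimes τ δ y.1.2 0 = τ 0 * y.1.2 := gridTimes_castSucc τ δ y.1.2 0
  have hscore := score_impactLikelihood (σ := σ) (τ₁ := τ 0) (δ := δ) (g := g) (h := h) (θ := θ)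
    (y := endpointPrices (y.1, fun k => almgrenChrissPrice S₀ σ (g θ) (h θ) y.1.1 y.1.2
      (fun t => W t y.2) (gridTimes τ δ y.1.2 k))) hgy hhy i
  have hcomp : (score (fun θ x => impactLikelihood σ (τ 0) δ (g θ) (h θ) (endpointPrices x)) θ i ∘
      fun y : (ℝ × ℝ) × Ω => (y.1, fun k => almgrenChrissPrice S₀ σ (g θ) (h θ) y.1.1 y.1.2
        (fun t => W t y.2) (gridTimes τ δ y.1.2 k))) y =
      (fderiv ℝ (fun θ => g θ y.1.1) θ (EuclideanSpace.single i 1) * W y.1.2.toNNReal y.2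
        + fderiv ℝ (fun θ => h θ y.1.1) θ (EuclideanSpace.single i 1) *
          (1 / (τ 0 * y.1.2) * W (τ 0 * y.1.2).toNNReal y.2
            + 1 / δ * (W y.1.2.toNNReal y.2 - W (y.1.2 + δ).toNNReal y.2))) / σ := by
    refine hscore.trans ?_
    simp only [endpointPrices, Matrix.cons_val_zero, Matrix.cons_val_one, Matrix.cons_val,
      hgrid0, gridTimes_castSucc, gridTimes_last, hτ_last, one_mul]
    rw [almgrenChrissPrice_of_le hS₀ (mul_le_of_le_one_left hT.le hτ0),
      almgrenChrissPrice_of_le hS₀ le_rfl, almgrenChrissPrice_of_lt hS₀ (by linarith)]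
    field_simp
    ring
  rw [hcomp]
  set a := fderiv ℝ (fun θ => g θ y.1.1) θ (EuclideanSpace.single i 1)
  set b := fderiv ℝ (fun θ => h θ y.1.1) θ (EuclideanSpace.single i 1)
  simp only [Pi.add_apply, Real.norm_eq_abs]
  generalize W y.1.2.toNNReal y.2 = w₁
  generalize W (τ 0 * y.1.2).toNNReal y.2 = w₀
  generalize W (y.1.2 + δ).toNNReal y.2 = w₂
  have hinv : 1 / (τ 0 * y.1.2) ≤ 1 / (τ 0 * T_L) := by
    gcongr
    exact hy.1
  have e1 : |1 / (τ 0 * y.1.2) * w₀ + 1 / δ * (w₁ - w₂)| ≤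
      1 / (τ 0 * T_L) * |w₀| + 1 / δ * (|w₁| + |w₂|) := by
    refine (abs_add_le _ _).trans (add_le_add ?_ ?_)
    · rw [abs_mul, abs_of_pos (by positivity : 0 < 1 / (τ 0 * y.1.2))]
      gcongr
    · rw [abs_mul, abs_of_pos (by positivity : 0 < 1 / δ)]
      gcongr
      exact abs_sub _ _
  rw [abs_div, div_mul_eq_mul_div |L|]
  refine div_le_div_of_nonneg_right ?_ (abs_nonneg σ)
  calc |a * w₁ + b * (1 / (τ 0 * y.1.2) * w₀ + 1 / δ * (w₁ - w₂))|
      ≤ |a| * |w₁| + |b| * |1 / (τ 0 * y.1.2) * w₀ + 1 / δ * (w₁ - w₂)| := by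
        rw [← abs_mul, ← abs_mul]; exact abs_add_le _ _
    _ ≤ |L| * |w₁| + |L| * (1 / (τ 0 * T_L) * |w₀| + 1 / δ * (|w₁| + |w₂|)) := by
        gcongr
    _ = |L| * (|w₁| + 1 / (τ 0 * T_L) * |w₀| + 1 / δ * (|w₁| + |w₂|)) := by ring

end SquareIntegrability

/-- `N = n + 1` trajectory prices at times `t_i = τ_i T`, `0 < τ_1 < ⋯ < τ_N = 1`, together with
the price at `T_post = T + δ`, have the same Fisher information as `(P_{t_1}, P_T, P_{T_post})`;
the Fisher information is unique, and it exists wherever the impact functions are locally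
Lipschitz in the parameter, uniformly over the orders. -/
theorem corollary1 {Ω : Type*} [MeasurableSpace Ω] (P : Measure Ω) [IsProbabilityMeasure P]
    (W : ℝ≥0 → Ω → ℝ) (hW : IsBrownianReal W P)
    {K : ℕ} (Θ : Set (EuclideanSpace ℝ (Fin K))) (hΘ : IsOpen Θ)
    (G : Measure (ℝ × ℝ)) [IsProbabilityMeasure G]
    (T_L T_U : ℝ) (hT_L : 0 < T_L) (hG : ∀ᵐ z ∂G, T_L ≤ z.2 ∧ z.2 ≤ T_U)
    (S₀ σ : ℝ) (hS₀ : 0 < S₀) (hσ : 0 < σ)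
    (g h : EuclideanSpace ℝ (Fin K) → ℝ → ℝ)
    (hg_meas : ∀ θ ∈ Θ, Measurable (g θ)) (hh_meas : ∀ θ ∈ Θ, Measurable (h θ))
    (hg_diff : ∀ᵐ z ∂G, DifferentiableOn ℝ (fun θ => g θ z.1) Θ)
    (hh_diff : ∀ᵐ z ∂G, DifferentiableOn ℝ (fun θ => h θ z.1) Θ)
    {n : ℕ} (τ : Fin (n + 1) → ℝ) (hτ : StrictMono τ) (hτ_pos : 0 < τ 0)
    (hτ_last : τ (Fin.last n) = 1) (δ : ℝ) (hδ : 0 < δ)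
    (θ : EuclideanSpace ℝ (Fin K)) (hθ : θ ∈ Θ) :
    (∀ A : Matrix (Fin K) (Fin K) ℝ,
      HasFisherInformation Θ
          (fun θ' => almgrenChrissLaw P W G S₀ σ (g θ') (h θ') (gridTimes τ δ)) θ A ↔
        HasFisherInformation Θ
          (fun θ' => almgrenChrissLaw P W G S₀ σ (g θ') (h θ') (threeTimes (τ 0) δ)) θ A) ∧
    (∀ A B : Matrix (Fin K) (Fin K) ℝ,
      HasFisherInformation Θ
          (fun θ' => almgrenChrissLaw P W G S₀ σ (g θ') (h θ') (gridTimes τ δ)) θ A →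
        HasFisherInformation Θ
          (fun θ' => almgrenChrissLaw P W G S₀ σ (g θ') (h θ') (gridTimes τ δ)) θ B →
        A = B) ∧
    ((∃ U ∈ 𝓝 θ, ∃ L : ℝ, ∀ᵐ z ∂G, ∀ θ' ∈ U, ∀ θ'' ∈ U,
        |g θ' z.1 - g θ'' z.1| ≤ L * ‖θ' - θ''‖ ∧ |h θ' z.1 - h θ'' z.1| ≤ L * ‖θ' - θ''‖) →
      ∃ A : Matrix (Fin K) (Fin K) ℝ,
        HasFisherInformation Θ
          (fun θ' => almgrenChrissLaw P W G S₀ σ (g θ') (h θ') (gridTimes τ δ)) θ A) := by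
  obtain ⟨W', hW', hWm, hae⟩ := hW.exists_measurable_modification
  simp only [almgrenChrissLaw_congr hae]
  have hGpos : ∀ᵐ z ∂G, 0 < z.2 := hG.mono fun z hz => hT_L.trans_le hz.1
  set Q := fun θ' => almgrenChrissLaw P W' G S₀ σ (g θ') (h θ') (gridTimes τ δ) with hQ_def
  -- The zero-impact law dominates all the others and does not depend on the parameter.
  let ν := almgrenChrissLaw P W' G S₀ σ 0 0 (gridTimes τ δ)
  let q : EuclideanSpace ℝ (Fin K) → (ℝ × ℝ) × (Fin 3 → ℝ) → ℝ :=
    fun θ' => impactLikelihood σ (τ 0) δ (g θ') (h θ')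
  have hq : ∀ θ' ∈ Θ, Measurable (q θ') := fun θ' hθ' =>
    measurable_impactLikelihood (hg_meas θ' hθ') (hh_meas θ' hθ')
  have hpos : ∀ θ' ∈ Θ, ∀ y, 0 < q θ' y := fun θ' _ y => Real.exp_pos _
  have hF := measurable_fst.prodMk (measurable_gridPrices hWm (S₀ := S₀) (σ := σ)
    (g := 0) (h := 0) measurable_const measurable_const τ δ)
  have : IsFiniteMeasure ν := Measure.isFiniteMeasure_map _ _
  -- The order keeps its law `G` under the reference measure, so the `G`-almost sure
  -- differentiability carries over to samples.
  have hfst : (ν.map endpointPrices).map Prod.fst = G := by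
    rw [Measure.map_map measurable_fst measurable_endpointPrices,
      show ν = _ from almgrenChrissLaw.eq_1 .., Measure.map_map
        (measurable_fst.comp measurable_endpointPrices) hF]
    exact Measure.map_fst_prod.trans (by simp)
  have hdiff : ∀ᵐ y ∂(ν.map endpointPrices), DifferentiableOn ℝ (fun θ' => q θ' y) Θ := by
    have := hg_diff.and hh_diff
    rw [← hfst] at this
    filter_upwards [ae_of_ae_map measurable_fst.aemeasurable this] with y ⟨hgy, hhy⟩
    simp only [q, impactLikelihood, impactLogLikelihood, div_eq_mul_inv]
    fun_prop
  have hQ : ∀ θ' ∈ Θ, Q θ' = ν.withDensity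
      (fun x => ENNReal.ofReal (q θ' (endpointPrices x))) := fun θ' hθ' =>
    almgrenChrissLaw_eq_withDensity hW' hWm hGpos hS₀.ne' hσ.ne' (hg_meas θ' hθ')
      (hh_meas θ' hθ') hτ hτ_pos hτ_last hδ
  have hlik := isLikelihood_comp measurable_endpointPrices hq hpos hdiff hQ
  have hlik_pos : ∀ θ' ∈ Θ, ∀ x : (ℝ × ℝ) × (Fin (n + 2) → ℝ), 0 < q θ' (endpointPrices x) :=
    fun θ' hθ' x => hpos θ' hθ' _
  refine ⟨fun A => ?_, fun A B hA hB => hA.unique hΘ hθ hlik hlik_pos hB, ?_⟩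
  · rw [hasFisherInformation_map_iff hΘ hθ measurable_endpointPrices hq hpos hdiff hQ A]
    exact hasFisherInformation_congr (fun θ' hθ' => map_endpointPrices_almgrenChrissLaw hWm G S₀ σ
      (hg_meas θ' hθ') (hh_meas θ' hθ') hτ_last δ) hθ A
  · rintro ⟨U, hU, L, hL⟩
    refine hlik.exists_hasFisherInformation fun i => ?_
    have hdiffAt {f : EuclideanSpace ℝ (Fin K) → ℝ → ℝ}
        (hf : ∀ᵐ z ∂G, DifferentiableOn ℝ (fun θ => f θ z.1) Θ) :
        ∀ᵐ z ∂G, DifferentiableAt ℝ (fun θ => f θ z.1) θ :=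
      hf.mono fun z hz => hz.differentiableAt (hΘ.mem_nhds hθ)
    exact memLp_score_impactLikelihood hW' hWm hT_L hG hS₀.ne' hσ.ne' (hg_meas θ hθ)
      (hh_meas θ hθ) (hdiffAt hg_diff) (hdiffAt hh_diff) hτ hτ_pos hτ_last hδ i (L := L)
      (hL.mono fun z hz => abs_fderiv_single_le hU (fun a ha b hb => (hz a ha b hb).1) i)
      (hL.mono fun z hz => abs_fderiv_single_le hU (fun a ha b hb => (hz a ha b hb).2) i)
      ((hlik.aestronglyMeasurable_score hΘ hθ hlik_pos i).mono_ac (hlik.absolutelyContinuous hθ))
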